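/- Let $\ell \ge 1$ and let $\Phi$ be a (reduced, crystallographic) root system of type $A_\ell$ in a Euclidean space $E$, with simple roots $\alpha_1,\dots,\alpha_\ell$ numbered consecutively along the Dynkin diagram and Weyl group $W$. Let $Z=\{x\in E : (\alpha,x)\in\mathbb{Z} \text{ for all } \alpha\in\Phi\}$ be the coweight lattice. For an integer $q>0$ put $$M(\Phi;q)=\{x+qZ\in Z/qZ : (\beta,x)\not\equiv 0 \pmod q \text{ for all } \beta\in\Phi\},$$ on which $W$ acts by $w(x+qZ)=w(x)+qZ$, and let $\chi_{\Phi,q}$ be the permutation character of $W$ on $M(\Phi;q)$. Let $w_0$ be the longest element of $W$ and, for $1\le j\le \ell$, let $w_j$ be the longest element of the subgroup of $W$ generated by the simple reflections $s_{\alpha_i}$, $i\ne j$. Put $\omega_0=1$ and $\omega_j=w_jw_0$ for $1\le j\le\ell$. Let $j\in\{0,\dots,\ell\}$, let $\omega=\omega_j$, let $g=\gcd(\ell+1,j)$ (so $g=\ell+1$ for $j=0$), and let $d$ be the order of $\omega$. Then for every integer $q>0$ $$\chi_{\Phi,q}(\omega)=\begin{cases}0 & \text{if } d\nmid q,\\ \varphi(d)\,(q-d)(q-2d)\cdots(q-d(g-1))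 & \text{if } d\mid q,\end{cases}$$ where $\varphi$ is Euler's totient function and the product over $k=1,\dots,g-1$ is $1$ when $g=1$. -/

import Mathlib

noncomputable section

namespace EquivariantQuasi

variable {ι M N : Type*} [AddCommGroup M] [Module ℝ M] [AddCommGroup N] [Module ℝ N]

/-- The action of the Weyl group on the space `N` in which coroots and coweights live. The group
`P.weylGroup` acts on `M` by `Equiv.weightEquiv` and `Equiv.coweightEquiv P P w` is the transpose of
`w`, so `w` acts on `N` as the transpose of `w⁻¹`; thus `⟨w • m, w • x⟩ = ⟨m, x⟩`
(see `root'_coweightAct`), and the reflection in a root acts by `P.coreflection`. -/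
def coweightAct (P : RootPairing ι ℝ M N) (w : P.weylGroup) : N ≃ₗ[ℝ] N :=
  RootPairing.Equiv.coweightEquiv P P (w : P.Aut)⁻¹

theorem coweightAct_one (P : RootPairing ι ℝ M N) (x : N) :
    coweightAct P 1 x = x := by
  simp [coweightAct]

theorem coweightAct_mul (P : RootPairing ι ℝ M N) (v w : P.weylGroup) (x : N) :
    coweightAct P (v * w) x = coweightAct P v (coweightAct P w x) := by
  simp [coweightAct]

theorem coweightAct_ofIdx (P : RootPairing ι ℝ M N) (i : ι) (x : N) :
    coweightAct P (RootPairing.weylGroup.ofIdx P i) x = P.coreflection i x := by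
  simp [coweightAct, RootPairing.weylGroup.ofIdx]

theorem root'_coweightAct (P : RootPairing ι ℝ M N) (w : P.weylGroup) (i : ι) (x : N) :
    P.root' i (coweightAct P w x) = P.root' (P.weylGroupToPerm w⁻¹ i) x := by
  have h := RootPairing.Hom.weight_coweight_transpose_apply P P x ((w : P.Aut)⁻¹).toHom
  have h2 := LinearMap.congr_fun h (P.root i)
  have h3 := RootPairing.Hom.root_weightMap_apply P P i ((w : P.Aut)⁻¹).toHom
  simp only [LinearMap.dualMap_apply, h3] at h2
  exact h2.symm

/-- The coweight lattice `Z`: the points at which every root takes an integral value. -/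
def coweightLattice (P : RootPairing ι ℝ M N) : AddSubgroup N where
  carrier := {x | ∀ i, ∃ k : ℤ, P.root' i x = k}
  zero_mem' := fun i => ⟨0, by simp⟩
  add_mem' := fun {x y} hx hy i => by
    obtain ⟨k, hk⟩ := hx i
    obtain ⟨l, hl⟩ := hy i
    exact ⟨k + l, by rw [map_add, hk, hl, Int.cast_add]⟩
  neg_mem' := fun {x} hx i => by
    obtain ⟨k, hk⟩ := hx i
    exact ⟨-k, by rw [map_neg, hk, Int.cast_neg]⟩

/-- The action of a Weyl group element on the coweight lattice. -/
def latticeAct (P : RootPairing ι ℝ M N) (w : P.weylGroup) :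
    coweightLattice P →+ coweightLattice P where
  toFun x := ⟨coweightAct P w x, fun i => by rw [root'_coweightAct]; exact x.2 _⟩
  map_zero' := by ext; simp
  map_add' x y := by ext; simp

/-- The subgroup `qZ` of the coweight lattice. -/
def multiples (P : RootPairing ι ℝ M N) (q : ℕ) : AddSubgroup (coweightLattice P) :=
  (nsmulAddMonoidHom q).range

/-- The finite group `Z / qZ`. -/
abbrev LatticeMod (P : RootPairing ι ℝ M N) (q : ℕ) : Type _ :=
  coweightLattice P ⧸ multiples P q

/-- The induced action of a Weyl group element on `Z / qZ`. -/
def modAct (P : RootPairing ι ℝ M N) (q : ℕ) (w : P.weylGroup) :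
    LatticeMod P q →+ LatticeMod P q :=
  QuotientAddGroup.map _ _ (latticeAct P w) (by
    rintro _ ⟨x, rfl⟩
    exact ⟨latticeAct P w x, by simp⟩)

/-- The complement `M(Φ; q)` of the Coxeter arrangement modulo `q`: the classes in `Z / qZ` of the
`x` such that `⟨β, x⟩ ≢ 0 (mod q)` for every root `β`. (The conditions for `β` and `-β` agree, so
`β` may equally range over the positive roots, and they depend only on the class of `x`.) -/
def complement (P : RootPairing ι ℝ M N) (q : ℕ) : Set (LatticeMod P q) :=
  {t | ∃ x : coweightLattice P, (QuotientAddGroup.mk x : LatticeMod P q) = t ∧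
    ∀ i, ¬ ∃ k : ℤ, P.root' i (x : N) = q * k}

theorem modAct_mem (P : RootPairing ι ℝ M N) (q : ℕ) (w : P.weylGroup) {t : LatticeMod P q}
    (ht : t ∈ complement P q) : modAct P q w t ∈ complement P q := by
  obtain ⟨x, rfl, hx⟩ := ht
  refine ⟨latticeAct P w x, rfl, fun i => ?_⟩
  have h : P.root' i (latticeAct P w x : N) = P.root' (P.weylGroupToPerm w⁻¹ i) x :=
    root'_coweightAct P w i x
  rw [h]
  exact hx _

/-- The action of the Weyl group on `M(Φ; q)`. -/
instance complementAction (P : RootPairing ι ℝ M N) (q : ℕ) :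
    MulAction P.weylGroup (complement P q) where
  smul w t := ⟨modAct P q w t, modAct_mem P q w t.2⟩
  one_smul := by
    rintro ⟨t, x, rfl, hx⟩
    refine Subtype.ext ?_
    change (QuotientAddGroup.mk (latticeAct P 1 x) : LatticeMod P q) = _
    congr 1
    exact Subtype.ext (coweightAct_one P x)
  mul_smul := by
    rintro v w ⟨t, x, rfl, hx⟩
    refine Subtype.ext ?_
    change (QuotientAddGroup.mk (latticeAct P (v * w) x) : LatticeMod P q) =
      QuotientAddGroup.mk (latticeAct P v (latticeAct P w x))
    congr 1
    exact Subtype.ext (coweightAct_mul P v w x)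

/-- The equivariant characteristic quasi-polynomial `χ_{Φ,q}`: the character of the permutation
representation of the Weyl group on `M(Φ; q)`. -/
def equivChar (P : RootPairing ι ℝ M N) (q : ℕ) (w : P.weylGroup) : ℂ :=
  (Representation.ofMulAction ℂ P.weylGroup (complement P q)).character w

/-- The subgroup of the Weyl group generated by the reflections in the roots indexed by `S`. -/
def reflSubgroup (P : RootPairing ι ℝ M N) (S : Set ι) : Subgroup P.weylGroup :=
  Subgroup.closure (RootPairing.weylGroup.ofIdx P '' S)

/-- The length of `w` with respect to the reflections in the roots indexed by `S`: the least number
of factors in an expression of `w` as a product of such reflections. -/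
def reflLength (P : RootPairing ι ℝ M N) (S : Set ι) (w : P.weylGroup) : ℕ :=
  sInf {n | ∃ l : List ι, (∀ i ∈ l, i ∈ S) ∧ l.length = n ∧
    (l.map (RootPairing.weylGroup.ofIdx P)).prod = w}

/-- `w` is an element of maximal length of the group generated by the reflections in `S`. -/
def IsLongest (P : RootPairing ι ℝ M N) (S : Set ι) (w : P.weylGroup) : Prop :=
  w ∈ reflSubgroup P S ∧ ∀ v ∈ reflSubgroup P S, reflLength P S v ≤ reflLength P S w

theorem finite_weylGroup [Finite ι] (P : RootPairing ι ℝ M N) [P.IsRootSystem] :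
    Finite P.weylGroup := by
  refine Finite.of_injective (fun w : P.weylGroup => P.weylGroupToPerm w) fun v w h => ?_
  refine Subtype.ext (RootPairing.Equiv.weightHom_injective P ?_)
  refine LinearEquiv.toLinearMap_injective ?_
  refine LinearMap.ext_on_range (v := P.root) (RootPairing.IsRootSystem.span_root_eq_top) fun i => ?_
  have hv := P.weylGroup_apply_root v i
  have hw := P.weylGroup_apply_root w i
  have h' : P.weylGroupToPerm v = P.weylGroupToPerm w := h
  rw [h', ← hw] at hv
  exact hv

theorem exists_isLongest [Finite ι] (P : RootPairing ι ℝ M N) [P.IsRootSystem] (S : Set ι) :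
    ∃ w, IsLongest P S w := by
  have := finite_weylGroup P
  obtain ⟨w, hw⟩ := Finite.exists_max fun v : reflSubgroup P S => reflLength P S (v : P.weylGroup)
  exact ⟨w, w.2, fun v hv => hw ⟨v, hv⟩⟩

/-- The longest element of the group generated by the reflections in `S` (which is unique when `S`
consists of simple roots). -/
def longest [Finite ι] (P : RootPairing ι ℝ M N) [P.IsRootSystem] (S : Set ι) : P.weylGroup :=
  (exists_isLongest P S).choose

/-- The elements `ω_0 = 1` and `ω_j = w_j w_0` for `1 ≤ j ≤ ℓ`, where `w_0` is the longest element
of the Weyl group and `w_j` that of the group generated by the simple reflections other than the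
`j`-th one. The simple roots are `α_j = P.root (e (j - 1))`, numbered by `e`. -/
def omega [Finite ι] {P : RootPairing ι ℝ M N} [P.IsRootSystem] (b : P.Base) {l : ℕ}
    (e : Fin l ≃ b.support) : Fin (l + 1) → P.weylGroup :=
  Fin.cases 1 fun i =>
    longest P ((b.support : Set ι) \ {(e i : ι)}) * longest P (b.support : Set ι)

/-- The base `b` is of type `A_l`, with its simple roots numbered by `e` along the Dynkin diagram. -/
def IsTypeA {P : RootPairing ι ℝ M N} [P.IsCrystallographic] (b : P.Base) {l : ℕ}
    (e : Fin l ≃ b.support) : Prop :=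
  b.cartanMatrix.submatrix e e = CartanMatrix.A l

end EquivariantQuasi

end

/-! Take coordinates x_0, ..., x_ℓ, up to a common shift, whose successive differences are the
simple roots. The roots are then exactly the differences x_a - x_c with a ≠ c, and W acts as the
full symmetric group on the indices (`permHom`). In a group generated by simple reflections that
omits at most one of them, length is the number of inversions. Hence w_0 reverses all indices, w_j
reverses the first j and the remaining ones separately, and ω_j becomes the translation i ↦ i + j of
ℤ/(ℓ+1) (`permHom_omega`). Adding back the common shift identifies Z/qZ × ℤ/q with all maps F :
ℤ/(ℓ+1) → ℤ/q. Points of M(Φ; q) correspond to injective F, and fixed points of ω_j to those with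
F(i + j) = F(i) + c for some c. Thus q · χ(ω_j) counts such F (`equivChar_mul`). Injectivity forces
c to have the order d of j, so there are φ(d) choices of c if d ∣ q and none otherwise. For fixed c,
F is determined by its values on representatives of the g = (ℓ+1)/d orbits of translation by j, and
these must lie in distinct cosets of ⟨c⟩. This leaves q(q-d)⋯(q-d(g-1)) choices (`card_shift_zmod`);
cancelling q gives the formula. -/

noncomputable section

namespace EquivariantQuasi

/-! ### Inversions and adjacent transpositions in the symmetric group. -/

section Permutations

variable {n : ℕ}

/-- The transposition of `k` and `k + 1`. -/
def adjSwap (k : Fin n) : Equiv.Perm (Fin (n + 1)) := Equiv.swap k.castSucc k.succ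

@[simp]
theorem adjSwap_mul_self (k : Fin n) : adjSwap k * adjSwap k = 1 := Equiv.swap_mul_self _ _

theorem val_adjSwap (k : Fin n) (i : Fin (n + 1)) :
    (adjSwap k i : ℕ) = if (i : ℕ) = k then (k : ℕ) + 1 else if (i : ℕ) = k + 1 then k else i := by
  simp only [adjSwap, Equiv.swap_apply_def, Fin.ext_iff]
  split_ifs <;> simp_all

/-- The inversions of a permutation. -/
def inversions (σ : Equiv.Perm (Fin n)) : Finset (Fin n × Fin n) :=
  Finset.univ.filter fun p => p.1 < p.2 ∧ σ p.2 < σ p.1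

theorem mem_inversions {σ : Equiv.Perm (Fin n)} {a b : Fin n} :
    (a, b) ∈ inversions σ ↔ a < b ∧ σ b < σ a := by
  simp [inversions]

/-- The number of inversions of a permutation. -/
def invCount (σ : Equiv.Perm (Fin n)) : ℕ := (inversions σ).card

theorem invCount_one : invCount (1 : Equiv.Perm (Fin n)) = 0 := by
  simp only [invCount, inversions, Finset.card_eq_zero, Finset.filter_eq_empty_iff]
  rintro ⟨a, b⟩ - ⟨h, h'⟩
  exact lt_asymm h h'

/-- The transposition preserves the order of every pair except the one it exchanges. Applied to both
entries of a pair, it therefore carries the inversions of the product to those of `σ` together with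
one extra, reversed pair. -/
theorem invCount_mul_adjSwap (σ : Equiv.Perm (Fin (n + 1))) (k : Fin n)
    (h : σ k.castSucc < σ k.succ) : invCount (σ * adjSwap k) = invCount σ + 1 := by
  have hnot : (k.succ, k.castSucc) ∉ inversions σ := by
    rw [mem_inversions]
    exact fun hk => lt_asymm hk.1 k.castSucc_lt_succ
  have himage : (inversions (σ * adjSwap k)).map
      ((Equiv.prodCongr (adjSwap k) (adjSwap k)).toEmbedding) =
      insert (k.succ, k.castSucc) (inversions σ) := by
    ext ⟨a, b⟩
    rw [Finset.mem_map_equiv, Finset.mem_insert]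
    have hs : (adjSwap k).symm = adjSwap k := Equiv.symm_swap _ _
    have hss : ∀ i, adjSwap k (adjSwap k i) = i := fun i => Equiv.swap_apply_self _ _ _
    simp only [Equiv.prodCongr_symm, Equiv.prodCongr_apply, Prod.map, hs, mem_inversions,
      Equiv.Perm.mul_apply, hss, Prod.mk.injEq]
    by_cases h1 : a = k.succ ∧ b = k.castSucc
    · obtain ⟨rfl, rfl⟩ := h1
      simp [h, adjSwap]
    by_cases h2 : a = k.castSucc ∧ b = k.succ
    · obtain ⟨rfl, rfl⟩ := h2
      simp only [not_lt_of_gt h, and_false, false_iff, not_or, not_and]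
      simp [Fin.ext_iff]
    · have : adjSwap k a < adjSwap k b ↔ a < b := by
        simp only [Fin.ext_iff, Fin.val_succ, Fin.val_castSucc] at h1 h2
        simp only [Fin.lt_def, val_adjSwap]
        split_ifs <;> omega
      simp [h1, this]
  rw [invCount, ← Finset.card_map, himage, Finset.card_insert_of_notMem hnot, invCount]

theorem invCount_mul_adjSwap_of_gt (σ : Equiv.Perm (Fin (n + 1))) (k : Fin n)
    (h : σ k.succ < σ k.castSucc) : invCount (σ * adjSwap k) + 1 = invCount σ := by
  rw [← invCount_mul_adjSwap, mul_assoc, adjSwap_mul_self, mul_one]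
  simpa [adjSwap] using h

theorem invCount_list_prod_le (L : List (Fin n)) :
    invCount (L.map adjSwap).prod ≤ L.length := by
  induction L using List.reverseRecOn with
  | nil => simp [invCount_one]
  | append_singleton L k ih =>
    simp only [List.map_append, List.prod_append, List.map_cons, List.map_nil, List.prod_singleton,
      List.length_append, List.length_singleton]
    rcases lt_or_gt_of_ne (show (L.map adjSwap).prod k.castSucc ≠ (L.map adjSwap).prod k.succ by
      simp [Fin.ext_iff]) with h | h
    · have := invCount_mul_adjSwap _ k h
      omega
    · have := invCount_mul_adjSwap_of_gt _ k h
      omega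

/-- The permutations that preserve the initial segment of length `m`. -/
def segmentStabilizer (n m : ℕ) : Subgroup (Equiv.Perm (Fin n)) where
  carrier := {σ | ∀ i, (σ i : ℕ) < m ↔ (i : ℕ) < m}
  one_mem' := by simp
  mul_mem' := fun {σ τ} hσ hτ i => by rw [Equiv.Perm.mul_apply, hσ, hτ]
  inv_mem' := fun {σ} hσ i => by simpa using (hσ (σ⁻¹ i)).symm

theorem adjSwap_mem_segmentStabilizer {m : ℕ} {k : Fin n} (hk : (k : ℕ) + 1 ≠ m) :
    adjSwap k ∈ segmentStabilizer (n + 1) m := by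
  intro i
  rw [val_adjSwap]
  split_ifs <;> omega

/-- A permutation that preserves two consecutive blocks and increases on each is trivial: climbing
from the start of a block gives `i ≤ σ i`, descending from its end gives `σ i ≤ i`. -/
theorem eq_one_of_mem_segmentStabilizer {m : ℕ} {σ : Equiv.Perm (Fin (n + 1))}
    (hσ : σ ∈ segmentStabilizer (n + 1) m)
    (h : ∀ k : Fin n, (k : ℕ) + 1 ≠ m → σ k.castSucc < σ k.succ) : σ = 1 := by
  have lower : ∀ i (hi : i < n + 1), i ≤ σ ⟨i, hi⟩ := by
    intro i
    induction i with
    | zero => simp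
    | succ i ih =>
      intro hi
      -- Nothing is known about the step across the block boundary; there the bound restarts because
      -- `σ` preserves the blocks.
      by_cases him : i + 1 = m
      · have := (hσ ⟨i + 1, hi⟩).not
        simp only [him] at this ⊢
        omega
      · have h1 := h ⟨i, by omega⟩ him
        have h2 := ih (by omega)
        simp only [Fin.castSucc_mk, Fin.succ_mk, Fin.lt_def] at h1
        omega
  have upper : ∀ t i (hi : i < n + 1), i + t = n → (σ ⟨i, hi⟩ : ℕ) ≤ i := by
    intro t
    induction t with
    | zero => intro i hi hit; have := (σ ⟨i, hi⟩).2; omega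
    | succ t ih =>
      intro i hi hit
      by_cases him : i + 1 = m
      · have := hσ ⟨i, hi⟩
        simp only at this
        omega
      · have h1 := h ⟨i, by omega⟩ him
        have h2 := ih (i + 1) (by omega) (by omega)
        simp only [Fin.castSucc_mk, Fin.succ_mk, Fin.lt_def] at h1
        omega
  ext i
  have h1 := lower i i.2
  have h2 := upper (n - i) i i.2 (by omega)
  exact le_antisymm h2 h1

/-- A permutation decreasing on each block reverses it. Along a block `σ i + i` cannot increase; its
value at the start is at most the sum of the block's two ends, and its value at the end is at least
that sum, so it is constant. For `m = 0` there is a single block. -/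
theorem val_of_mem_segmentStabilizer_of_gt {m : ℕ} {σ : Equiv.Perm (Fin (n + 1))}
    (hσ : σ ∈ segmentStabilizer (n + 1) m)
    (h : ∀ k : Fin n, (k : ℕ) + 1 ≠ m → σ k.succ < σ k.castSucc) (i : Fin (n + 1)) :
    (σ i : ℕ) + i + 1 = if (i : ℕ) < m then min m (n + 1) else n + 1 + m := by
  have upper : ∀ i (hi : i < n + 1), (σ ⟨i, hi⟩ : ℕ) + i + 1 ≤
      if i < m then min m (n + 1) else n + 1 + m := by
    intro i
    induction i with
    | zero =>
      intro hi
      have h1 := hσ ⟨0, hi⟩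
      have h2 := (σ ⟨0, hi⟩).2
      simp only at h1
      split_ifs <;> omega
    | succ i ih =>
      intro hi
      have h3 := (σ ⟨i + 1, hi⟩).2
      by_cases him : i + 1 = m
      · rw [if_neg (by omega)]
        omega
      · have h1 := h ⟨i, by omega⟩ him
        have h2 := ih (by omega)
        simp only [Fin.castSucc_mk, Fin.succ_mk, Fin.lt_def] at h1
        split_ifs at h2 ⊢ <;> omega
  have lower : ∀ t i (hi : i < n + 1), i + t = n →
      (if i < m then min m (n + 1) else n + 1 + m) ≤ (σ ⟨i, hi⟩ : ℕ) + i + 1 := by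
    intro t
    induction t with
    | zero =>
      intro i hi hit
      have h1 := hσ ⟨i, hi⟩
      simp only at h1
      split_ifs <;> omega
    | succ t ih =>
      intro i hi hit
      by_cases him : i + 1 = m
      · rw [if_pos (by omega)]
        omega
      · have h1 := h ⟨i, by omega⟩ him
        have h2 := ih (i + 1) (by omega) (by omega)
        simp only [Fin.castSucc_mk, Fin.succ_mk, Fin.lt_def] at h1
        split_ifs at h2 ⊢ <;> omega
  exact le_antisymm (upper i i.2) (lower (n - i) i i.2 (by omega))

/-- Bubble sort: as long as `σ ≠ 1` there is a descent inside a block, and removing it lowers the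
inversion count by one. With `invCount_list_prod_le` this makes word length equal to the number of
inversions. -/
theorem exists_list_adjSwap_prod {m : ℕ} (σ : Equiv.Perm (Fin (n + 1)))
    (hσ : σ ∈ segmentStabilizer (n + 1) m) :
    ∃ L : List (Fin n), (∀ k ∈ L, (k : ℕ) + 1 ≠ m) ∧ L.length = invCount σ ∧
      (L.map adjSwap).prod = σ := by
  induction hc : invCount σ generalizing σ with
  | zero =>
    refine ⟨[], by simp, rfl, ?_⟩
    refine (eq_one_of_mem_segmentStabilizer hσ fun k _ => ?_).symm
    by_contra hk
    have hlt : σ k.succ < σ k.castSucc :=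
      lt_of_le_of_ne (not_lt.1 hk) (by simp [Fin.ext_iff])
    have := invCount_mul_adjSwap_of_gt σ k hlt
    omega
  | succ c ih =>
    have : ∃ k : Fin n, (k : ℕ) + 1 ≠ m ∧ σ k.succ < σ k.castSucc := by
      by_contra! hno
      rw [eq_one_of_mem_segmentStabilizer hσ fun k hk =>
        lt_of_le_of_ne (hno k hk) (by simp [Fin.ext_iff]), invCount_one] at hc
      omega
    obtain ⟨k, hkm, hk⟩ := this
    have hinv := invCount_mul_adjSwap_of_gt σ k hk
    obtain ⟨L, hL, hlen, hprod⟩ := ih (σ * adjSwap k)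
      (mul_mem hσ (adjSwap_mem_segmentStabilizer hkm)) (by omega)
    refine ⟨L ++ [k], ?_, by simp [hlen], ?_⟩
    · intro x hx
      rcases List.mem_append.1 hx with hx | hx
      · exact hL x hx
      · rwa [List.mem_singleton.1 hx]
    · simp [hprod, mul_assoc]

end Permutations

/-! ### Coordinates on the coweight space and the action of W on them. -/

section Coordinates

theorem exists_eq_add_of_succ_sub_eq {A : Type*} [AddCommGroup A] {n : ℕ} (u v : Fin (n + 1) → A)
    (h : ∀ k : Fin n, u k.succ - u k.castSucc = v k.succ - v k.castSucc) :
    ∃ c, ∀ i, u i = v i + c := by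
  refine ⟨u 0 - v 0, fun i => ?_⟩
  induction i using Fin.induction with
  | zero => abel
  | succ k ih =>
    rw [← sub_eq_iff_eq_add'] at ih ⊢
    rw [← ih, sub_eq_sub_iff_sub_eq_sub]
    exact h k

variable {ι M N : Type*} [AddCommGroup M] [Module ℝ M] [AddCommGroup N] [Module ℝ N]
  {P : RootPairing ι ℝ M N} (b : P.Base) {l : ℕ} (e : Fin l ≃ b.support)

/-- The coordinates on `N` whose successive differences are the simple roots, normalized to vanish
at the first index. -/
def coord (x : N) (i : Fin (l + 1)) : ℝ :=
  ∑ k : Fin l, if (k : ℕ) < i then P.root' (e k) x else 0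

theorem coord_zero_index (x : N) : coord b e x 0 = 0 := by simp [coord]

theorem coord_succ_sub (x : N) (k : Fin l) :
    coord b e x k.succ - coord b e x k.castSucc = P.root' (e k) x := by
  rw [coord, coord, ← Finset.sum_sub_distrib, Finset.sum_eq_single k]
  · simp
  · intro m _ hm
    rw [Ne, Fin.ext_iff] at hm
    have : (m : ℕ) < (k : ℕ) + 1 ↔ (m : ℕ) < k := by omega
    simp [this]
  · simp

theorem coord_add (x y : N) (i : Fin (l + 1)) :
    coord b e (x + y) i = coord b e x i + coord b e y i := by
  simp only [coord, ← Finset.sum_add_distrib]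
  refine Finset.sum_congr rfl fun k _ => ?_
  split_ifs <;> simp

/-- `σ` is the permutation of the coordinates, up to a common shift, induced by `w`. -/
def ActsAs (w : P.weylGroup) (σ : Equiv.Perm (Fin (l + 1))) : Prop :=
  ∀ x, ∃ c, ∀ i, coord b e (coweightAct P w x) (σ i) = coord b e x i + c

theorem ActsAs.one : ActsAs b e 1 1 := fun x => ⟨0, fun i => by simp [coweightAct_one]⟩

variable {b e}

theorem ActsAs.mul {v w : P.weylGroup} {σ τ : Equiv.Perm (Fin (l + 1))}
    (hv : ActsAs b e v σ) (hw : ActsAs b e w τ) : ActsAs b e (v * w) (σ * τ) := by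
  intro x
  obtain ⟨c, hc⟩ := hw x
  obtain ⟨c', hc'⟩ := hv (coweightAct P w x)
  exact ⟨c + c', fun i => by
    rw [coweightAct_mul, Equiv.Perm.mul_apply, hc', hc, add_assoc]⟩

theorem coord_of_actsAs {w : P.weylGroup} {σ : Equiv.Perm (Fin (l + 1))} (h : ActsAs b e w σ)
    (x : N) (i i' : Fin (l + 1)) :
    coord b e (coweightAct P w x) (σ i) - coord b e (coweightAct P w x) (σ i') =
      coord b e x i - coord b e x i' := by
  obtain ⟨c, hc⟩ := h x
  rw [hc, hc]
  abel

variable (b e) in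
-- The simple roots form a basis of `M` and the pairing is perfect, so their values on a point can
-- be prescribed freely.
theorem exists_root'_eq [P.IsRootSystem] (a : Fin l → ℝ) :
    ∃ x : N, ∀ k, P.root' (e k) x = a k := by
  refine ⟨P.toLinearMap.flip.toPerfPair.symm
    (b.toWeightBasis.constr ℝ fun i => a (e.symm i)), fun k => ?_⟩
  have h : P.toLinearMap.flip.toPerfPair (P.toLinearMap.flip.toPerfPair.symm
    (b.toWeightBasis.constr ℝ fun i => a (e.symm i))) (P.root (e k)) = a k := by
    rw [LinearEquiv.apply_symm_apply, ← b.toWeightBasis_apply, Module.Basis.constr_basis,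
      e.symm_apply_apply]
  exact h

theorem eq_of_root'_eq [P.IsRootSystem] {x y : N}
    (h : ∀ k, P.root' (e k) x = P.root' (e k) y) : x = y := by
  refine P.toLinearMap.flip.toPerfPair.injective (b.toWeightBasis.ext fun i => ?_)
  obtain ⟨k, rfl⟩ := e.surjective i
  rw [b.toWeightBasis_apply]
  exact h k

variable (b e) in
theorem exists_coord_strictMono [P.IsRootSystem] : ∃ x : N, StrictMono (coord b e x) := by
  obtain ⟨x, hx⟩ := exists_root'_eq b e fun _ => 1
  refine ⟨x, Fin.strictMono_iff_lt_succ.2 fun k => ?_⟩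
  have := coord_succ_sub b e x k
  rw [hx] at this
  linarith

/-- On a point with strictly increasing coordinates, both permutations are read off from the order
of the coordinates of its image. So `σ⁻¹ * τ` is strictly monotone in both directions, hence
trivial. -/
theorem ActsAs.unique [P.IsRootSystem] {w : P.weylGroup} {σ τ : Equiv.Perm (Fin (l + 1))}
    (hσ : ActsAs b e w σ) (hτ : ActsAs b e w τ) : σ = τ := by
  obtain ⟨x, hx⟩ := exists_coord_strictMono b e
  have hmono : ∀ {ρ ρ' : Equiv.Perm (Fin (l + 1))}, ActsAs b e w ρ → ActsAs b e w ρ' →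
      StrictMono (ρ⁻¹ * ρ') := by
    intro ρ ρ' h h' i i' hii
    rw [← hx.lt_iff_lt, ← sub_neg, ← coord_of_actsAs h]
    simp only [Equiv.Perm.mul_apply]
    rw [Equiv.Perm.inv_def, Equiv.apply_symm_apply, Equiv.apply_symm_apply,
      coord_of_actsAs h', sub_neg]
    exact hx hii
  have h1 : σ⁻¹ * τ = 1 := by
    ext i
    have h2 := (hmono hσ hτ).id_le i
    have h3 := (hmono hτ hσ).id_le ((σ⁻¹ * τ) i)
    simp only [id, Equiv.Perm.mul_apply, Equiv.Perm.inv_def, Equiv.apply_symm_apply,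
      Equiv.symm_apply_apply] at h2 h3
    exact congrArg _ (le_antisymm h3 h2)
  exact (inv_mul_eq_one.1 h1)

theorem ActsAs.eq_one [P.IsRootSystem] {w : P.weylGroup} (h : ActsAs b e w 1) : w = 1 := by
  have hx : ∀ x, coweightAct P w x = x := fun x => eq_of_root'_eq (e := e) fun k => by
    rw [← coord_succ_sub, ← coord_succ_sub]
    exact coord_of_actsAs h x _ _
  refine Subtype.ext (inv_eq_one.1 ?_)
  refine RootPairing.Equiv.coweightHom_injective P ?_
  rw [map_one]
  refine MulOpposite.unop_injective (LinearEquiv.ext fun x => ?_)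
  exact hx x

theorem root'_reflectionPerm (i j : ι) (x : N) :
    P.root' (P.reflectionPerm j i) x = P.root' i (P.coreflection j x) := by
  have h := root'_coweightAct P (RootPairing.weylGroup.ofIdx P j) i x
  rw [coweightAct_ofIdx] at h
  rw [h]
  have : (RootPairing.weylGroup.ofIdx P j)⁻¹ = RootPairing.weylGroup.ofIdx P j := by
    ext : 1
    simp [RootPairing.weylGroup.ofIdx]
  rw [this]
  rfl

theorem ofIdx_reflectionPerm (i j : ι) :
    RootPairing.weylGroup.ofIdx P (P.reflectionPerm j i) =
      RootPairing.weylGroup.ofIdx P j * RootPairing.weylGroup.ofIdx P i *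
        RootPairing.weylGroup.ofIdx P j := by
  refine Subtype.ext (RootPairing.Equiv.weightHom_injective P ?_)
  simp only [RootPairing.weylGroup.ofIdx, Subgroup.coe_mul, map_mul]
  simp [RootPairing.reflection_reflectionPerm]

variable [P.IsCrystallographic]

/-- By the Cartan matrix, the reflection negates the k-th successive difference and adds it to its
neighbours, which is the effect of exchanging two adjacent coordinates. Agreement holds only up to a
shift, since `coord` is normalized at index 0, which the swap may move. -/
theorem actsAs_simple (hA : IsTypeA b e) (k : Fin l) :
    ActsAs b e (RootPairing.weylGroup.ofIdx P (e k)) (adjSwap k) := by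
  intro x
  obtain ⟨c, hc⟩ := exists_eq_add_of_succ_sub_eq
    (coord b e (P.coreflection (e k) x)) (fun i => coord b e x (adjSwap k i)) fun m => by
      have hpair : P.root' (e m) (P.coroot (e k)) = (CartanMatrix.A l m k : ℝ) := by
        have h1 : b.cartanMatrix (e m) (e k) = CartanMatrix.A l m k := by
          rw [← hA]; rfl
        rw [← h1]
        simpa using (b.algebraMap_cartanMatrixIn_apply ℤ (e m) (e k)).symm
      rw [coord_succ_sub, RootPairing.coreflection_apply, map_sub, map_smul, hpair,
        ← coord_succ_sub b e, ← coord_succ_sub b e, smul_eq_mul]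
      simp only [CartanMatrix.A, Matrix.of_apply]
      by_cases h0 : m = k
      · subst h0
        simp only [adjSwap, Equiv.swap_apply_left, Equiv.swap_apply_right, if_true]
        push_cast
        ring
      rw [if_neg h0]
      rw [Fin.ext_iff] at h0
      by_cases h1 : (m : ℕ) + 1 = k
      · have h2 : m.succ = k.castSucc := Fin.ext h1
        have h3 : adjSwap k m.castSucc = m.castSucc :=
          Equiv.swap_apply_of_ne_of_ne (by simp [Fin.ext_iff, h0]) (by simp [Fin.ext_iff]; omega)
        rw [if_pos (Or.inl h1), h3, h2, adjSwap, Equiv.swap_apply_left]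
        push_cast
        ring
      by_cases h2 : (k : ℕ) + 1 = m
      · have h3 : m.castSucc = k.succ := Fin.ext h2.symm
        have h4 : adjSwap k m.succ = m.succ :=
          Equiv.swap_apply_of_ne_of_ne (by simp [Fin.ext_iff, h1]) (by simp [Fin.ext_iff, h0])
        rw [if_pos (Or.inr h2), h4, h3, adjSwap, Equiv.swap_apply_right]
        push_cast
        ring
      · have h3 : adjSwap k m.castSucc = m.castSucc :=
          Equiv.swap_apply_of_ne_of_ne (by simp [Fin.ext_iff, h0])
            (by simp [Fin.ext_iff]; omega)
        have h4 : adjSwap k m.succ = m.succ :=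
          Equiv.swap_apply_of_ne_of_ne (by simp [Fin.ext_iff, h1]) (by simp [Fin.ext_iff, h0])
        rw [if_neg (by omega), h3, h4]
        simp
  refine ⟨c, fun i => ?_⟩
  rw [coweightAct_ofIdx, hc]
  simp [adjSwap]

variable [Finite ι] [P.IsReduced]

/-- Reflecting a root conjugates its reflection, so the property spreads from the simple reflections
to all reflections, and from these to the group they generate. -/
theorem exists_actsAs (hA : IsTypeA b e) (w : P.weylGroup) : ∃ σ, ActsAs b e w σ := by
  have hrefl : ∀ i, ∃ σ, ActsAs b e (RootPairing.weylGroup.ofIdx P i) σ := by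
    intro i
    induction i using b.induction_reflect with
    | h₀ i ih =>
      obtain ⟨σ, hσ⟩ := ih
      rw [ofIdx_reflectionPerm]
      exact ⟨_, (hσ.mul hσ).mul hσ⟩
    | h₁ i hi =>
      obtain ⟨k, hk⟩ := e.surjective ⟨i, hi⟩
      have := actsAs_simple hA k
      rw [hk] at this
      exact ⟨_, this⟩
    | h₂ i j hi hj =>
      obtain ⟨σ, hσ⟩ := hi
      obtain ⟨k, hk⟩ := e.surjective ⟨j, hj⟩
      have h := actsAs_simple hA k
      rw [hk] at h
      rw [ofIdx_reflectionPerm]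
      exact ⟨_, (h.mul hσ).mul h⟩
  obtain ⟨w, hw⟩ := w
  induction hw using RootPairing.weylGroup.induction with
  | mem i => exact hrefl i
  | one => exact ⟨1, ActsAs.one b e⟩
  | mul v w hv hw ihv ihw =>
    obtain ⟨σ, hσ⟩ := ihv
    obtain ⟨τ, hτ⟩ := ihw
    exact ⟨σ * τ, ActsAs.mul (v := ⟨v, hv⟩) (w := ⟨w, hw⟩) hσ hτ⟩

/-- True for simple roots, and preserved by simple reflections because they permute the coordinates
up to a shift, which cancels in a difference. -/
theorem exists_root'_eq_coord_sub (hA : IsTypeA b e) (i : ι) :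
    ∃ a c, a ≠ c ∧ ∀ x, P.root' i x = coord b e x a - coord b e x c := by
  induction i using b.induction_reflect with
  | h₀ i ih =>
    obtain ⟨a, c, hac, h⟩ := ih
    refine ⟨c, a, hac.symm, fun x => ?_⟩
    rw [root'_reflectionPerm, RootPairing.coreflection_apply, map_sub, map_smul,
      RootPairing.root'_coroot_eq_pairing, RootPairing.pairing_same, h, smul_eq_mul]
    ring
  | h₁ i hi =>
    obtain ⟨k, hk⟩ := e.surjective ⟨i, hi⟩
    refine ⟨k.succ, k.castSucc, by simp [Fin.ext_iff], fun x => ?_⟩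
    rw [coord_succ_sub, hk]
  | h₂ i j hi hj =>
    obtain ⟨a, c, hac, h⟩ := hi
    obtain ⟨k, hk⟩ := e.surjective ⟨j, hj⟩
    refine ⟨(adjSwap k)⁻¹ a, (adjSwap k)⁻¹ c, by simpa using hac, fun x => ?_⟩
    have h1 := actsAs_simple hA k
    rw [hk] at h1
    rw [root'_reflectionPerm, h, ← coweightAct_ofIdx, ← coord_of_actsAs h1 x]
    simp

/-! ### The isomorphism of W with the symmetric group; longest elements and ω_j. -/

variable [P.IsRootSystem]

/-- The homomorphism from the Weyl group of type `A_l` to the symmetric group. -/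
def permHom (hA : IsTypeA b e) : P.weylGroup →* Equiv.Perm (Fin (l + 1)) :=
  MonoidHom.mk' (fun w => (exists_actsAs hA w).choose) fun v w =>
    (exists_actsAs hA (v * w)).choose_spec.unique
      ((exists_actsAs hA v).choose_spec.mul (exists_actsAs hA w).choose_spec)

theorem actsAs_permHom (hA : IsTypeA b e) (w : P.weylGroup) : ActsAs b e w (permHom hA w) :=
  (exists_actsAs hA w).choose_spec

theorem permHom_injective (hA : IsTypeA b e) : Function.Injective (permHom hA) := by
  refine (injective_iff_map_eq_one _).2 fun w hw => ?_
  have := actsAs_permHom hA w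
  rw [hw] at this
  exact this.eq_one

@[simp]
theorem permHom_simple (hA : IsTypeA b e) (k : Fin l) :
    permHom hA (RootPairing.weylGroup.ofIdx P (e k)) = adjSwap k :=
  (actsAs_permHom hA _).unique (actsAs_simple hA k)

theorem permHom_surjective (hA : IsTypeA b e) : Function.Surjective (permHom hA) := by
  rw [← MonoidHom.mrange_eq_top, ← top_le_iff, ← Equiv.Perm.mclosure_swap_castSucc_succ,
    Submonoid.closure_le]
  rintro _ ⟨k, rfl⟩
  exact ⟨_, permHom_simple hA k⟩

/-- The symmetric group is 2-transitive, so every difference of two coordinates is a W-image of the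
first simple root `x_1 - x_0`. -/
theorem exists_root'_eq_coord_sub_of_ne (hA : IsTypeA b e) {a c : Fin (l + 1)} (hac : a ≠ c) :
    ∃ i, ∀ x, P.root' i x = coord b e x a - coord b e x c := by
  cases l with
  | zero => exact absurd (Fin.ext (by omega)) hac
  | succ l =>
    obtain ⟨σ, hσ1, hσ0⟩ : ∃ σ : Equiv.Perm (Fin (l + 2)), σ 1 = a ∧ σ 0 = c := by
      have := Equiv.Perm.isMultiplyPretransitive (Fin (l + 2)) 2
      rw [MulAction.is_two_pretransitive_iff] at this
      exact this (by simp) hac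
    obtain ⟨w, hw⟩ := permHom_surjective hA σ⁻¹
    refine ⟨P.weylGroupToPerm w⁻¹ (e 0), fun x => ?_⟩
    have h := actsAs_permHom hA w
    rw [hw] at h
    rw [← root'_coweightAct, ← coord_succ_sub b e, ← coord_of_actsAs h x, ← hσ1, ← hσ0]
    simp

theorem reflSubgroup_le (hA : IsTypeA b e) {m : ℕ} {S : Set ι}
    (hS : S = (fun k => (e k : ι)) '' {k | (k : ℕ) + 1 ≠ m}) :
    reflSubgroup P S ≤ (segmentStabilizer (l + 1) m).comap (permHom hA) := by
  rw [reflSubgroup, Subgroup.closure_le, hS]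
  rintro _ ⟨_, ⟨k, hk, rfl⟩, rfl⟩
  simpa using adjSwap_mem_segmentStabilizer hk

theorem permHom_list_prod (hA : IsTypeA b e) (L : List (Fin l)) :
    permHom hA ((L.map fun k => (e k : ι)).map (RootPairing.weylGroup.ofIdx P)).prod =
      (L.map adjSwap).prod := by
  rw [map_list_prod, List.map_map, List.map_map]
  congr 1
  exact List.map_congr_left fun k _ => permHom_simple hA k

/-- The parameter `m` treats both cases at once: `m = 0` excludes no simple reflection and gives W,
while `m = j ≥ 1` drops the j-th one. -/
theorem reflLength_eq (hA : IsTypeA b e) {m : ℕ} {S : Set ι}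
    (hS : S = (fun k => (e k : ι)) '' {k | (k : ℕ) + 1 ≠ m}) {w : P.weylGroup}
    (hw : w ∈ reflSubgroup P S) : reflLength P S w = invCount (permHom hA w) := by
  obtain ⟨L, hL, hlen, hprod⟩ := exists_list_adjSwap_prod _ (reflSubgroup_le hA hS hw)
  have hmem : invCount (permHom hA w) ∈ {n | ∃ l : List ι, (∀ i ∈ l, i ∈ S) ∧ l.length = n ∧
      (l.map (RootPairing.weylGroup.ofIdx P)).prod = w} := by
    refine ⟨L.map fun k => (e k : ι), ?_, by simpa using hlen, ?_⟩
    · intro i hi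
      obtain ⟨k, hk, rfl⟩ := List.mem_map.1 hi
      rw [hS]
      exact ⟨k, hL k hk, rfl⟩
    · apply permHom_injective hA
      rw [permHom_list_prod, hprod]
  refine le_antisymm (Nat.sInf_le hmem) (le_csInf ⟨_, hmem⟩ ?_)
  rintro _ ⟨L', hL', rfl, hw'⟩
  obtain ⟨L'', rfl⟩ : ∃ L'' : List (Fin l), L''.map (fun k => (e k : ι)) = L' := by
    rw [← Set.mem_range, Set.range_list_map]
    intro i hi
    have := hL' i hi
    rw [hS] at this
    obtain ⟨k, -, rfl⟩ := this
    exact ⟨k, rfl⟩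
  rw [← hw', permHom_list_prod, List.length_map]
  exact invCount_list_prod_le L''

/-- An ascent inside a block could be swapped to gain an inversion, contradicting maximality; so the
permutation decreases on each block. This pins down any longest element without a separate
uniqueness argument. -/
theorem IsLongest.val_permHom (hA : IsTypeA b e) {m : ℕ} {S : Set ι}
    (hS : S = (fun k => (e k : ι)) '' {k | (k : ℕ) + 1 ≠ m}) {w : P.weylGroup}
    (hw : IsLongest P S w) (i : Fin (l + 1)) :
    (permHom hA w i : ℕ) + i + 1 = if (i : ℕ) < m then min m (l + 1) else l + 1 + m := by
  refine val_of_mem_segmentStabilizer_of_gt (reflSubgroup_le hA hS hw.1) (fun k hk => ?_) i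
  by_contra hlt
  have hmem : w * RootPairing.weylGroup.ofIdx P (e k) ∈ reflSubgroup P S := by
    refine mul_mem hw.1 (Subgroup.subset_closure ⟨_, ?_, rfl⟩)
    rw [hS]
    exact ⟨k, hk, rfl⟩
  have h1 := hw.2 _ hmem
  rw [reflLength_eq hA hS hmem, reflLength_eq hA hS hw.1, map_mul, permHom_simple,
    invCount_mul_adjSwap _ _ (lt_of_le_of_ne (not_lt.1 hlt) (by simp [Fin.ext_iff]))] at h1
  omega

/-- Here w_0 sends i to ℓ - i, and w_j sends r to j - 1 - r if r < j and to ℓ + j - r otherwise. The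
composite is i + j - (ℓ+1) or i + j respectively, which is addition in `Fin (l + 1)`. -/
theorem permHom_omega (hA : IsTypeA b e) (j : Fin (l + 1)) :
    permHom hA (omega b e j) = Equiv.addRight j := by
  cases j using Fin.cases with
  | zero =>
    ext i
    simp [omega]
  | succ k =>
    have hS0 : (b.support : Set ι) = (fun k => (e k : ι)) '' {k : Fin l | (k : ℕ) + 1 ≠ 0} := by
      ext i
      simp only [ne_eq, Nat.add_eq_zero_iff, one_ne_zero, and_false, not_false_eq_true,
        Set.ofPred_true, Set.image_univ, Set.mem_range, Finset.mem_coe]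
      refine ⟨fun hi => ⟨e.symm ⟨i, hi⟩, by simp⟩, ?_⟩
      rintro ⟨k, rfl⟩
      exact (e k).2
    have hS1 : (b.support : Set ι) \ {(e k : ι)} =
        (fun k => (e k : ι)) '' {r : Fin l | (r : ℕ) + 1 ≠ (k : ℕ) + 1} := by
      rw [hS0]
      ext i
      constructor
      · rintro ⟨⟨k', -, rfl⟩, h⟩
        refine ⟨k', fun h' => h ?_, rfl⟩
        rw [show k' = k from Fin.ext (by omega)]
        rfl
      · rintro ⟨k', h, rfl⟩
        refine ⟨⟨k', by simp, rfl⟩, fun h' => h ?_⟩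
        rw [e.injective (Subtype.ext h')]
    ext i
    have h0 := (exists_isLongest P (b.support : Set ι)).choose_spec.val_permHom hA hS0 i
    have h1 := (exists_isLongest P ((b.support : Set ι) \ {(e k : ι)})).choose_spec.val_permHom hA
      hS1 (permHom hA (longest P (b.support : Set ι)) i)
    change (permHom hA (longest P (b.support : Set ι)) i : ℕ) + i + 1 = _ at h0
    change (permHom hA (longest P ((b.support : Set ι) \ {(e k : ι)}))
      (permHom hA (longest P (b.support : Set ι)) i) : ℕ) + _ + 1 = _ at h1
    rw [if_neg (by omega)] at h0
    simp only [omega, Fin.cases_succ, map_mul, Equiv.Perm.mul_apply, Equiv.coe_addRight,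
      Fin.val_add_eq_ite, Fin.val_succ]
    split_ifs at h1 ⊢ <;> omega

end Coordinates

/-! ### Counting injections that intertwine two translations. -/

section Counting

variable {G H : Type*} [AddCommGroup G] [AddCommGroup H]

/-- The injective maps that intertwine translation by `j` with translation by `c`. -/
abbrev ShiftInj (j : G) (c : H) : Type _ :=
  {F : G → H // Function.Injective F ∧ ∀ i, F (i + j) = F i + c}

theorem ShiftInj.apply_add_zsmul {j : G} {c : H} (F : ShiftInj j c) (i : G) (k : ℤ) :
    F.1 (i + k • j) = F.1 i + k • c := by
  induction k with
  | zero => simp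
  | succ k ih => rw [add_zsmul, one_zsmul, ← add_assoc, F.2.2, ih, add_zsmul, one_zsmul, add_assoc]
  | pred k ih =>
    have h := F.2.2 (i + (-(k : ℤ) - 1) • j)
    rw [add_assoc, ← add_one_zsmul, sub_add_cancel, ih] at h
    rw [← add_left_inj c, ← h, add_assoc, ← add_one_zsmul, sub_add_cancel]

/-- Since F(kj) = F(0) + kc and F is injective, kj = 0 exactly when kc = 0. -/
theorem ShiftInj.addOrderOf_eq {j : G} {c : H} (F : ShiftInj j c) :
    addOrderOf c = addOrderOf j := by
  refine addOrderOf_eq_addOrderOf_iff.2 fun k => ?_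
  have h := F.apply_add_zsmul 0 k
  rw [natCast_zsmul, natCast_zsmul, zero_add] at h
  constructor
  · intro hk
    rw [hk, add_zero] at h
    exact F.2.1 h
  · intro hk
    rw [hk] at h
    exact left_eq_add.1 h

/-- Makes the extension along an orbit independent of the integer multiple of `j` chosen to reach a
point. -/
theorem zsmul_eq_zsmul_iff_of_addOrderOf_eq {j : G} {c : H} (hd : addOrderOf j = addOrderOf c)
    (k k' : ℤ) : k • j = k' • j ↔ k • c = k' • c := by
  rw [← sub_eq_zero, ← sub_smul, ← addOrderOf_dvd_iff_zsmul_eq_zero, hd,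
    addOrderOf_dvd_iff_zsmul_eq_zero, sub_smul, sub_eq_zero]

theorem sub_out_mem (C : AddSubgroup G) (i : G) : i - (i : G ⧸ C).out ∈ C := by
  rw [← QuotientAddGroup.eq_iff_sub_mem, QuotientAddGroup.out_eq']

open AddSubgroup in
/-- A map intertwining two translations of the same order is determined by its values on
representatives of the orbits; it is injective when these values lie in distinct orbits. -/
def shiftInjEquiv {j : G} {c : H} (hd : addOrderOf j = addOrderOf c) :
    ShiftInj j c ≃ {y : G ⧸ zmultiples j → H //
      Function.Injective fun o => (y o : H ⧸ zmultiples c)} :=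
  have hex : ∀ i : G, ∃ k : ℤ, k • j = i - (i : G ⧸ zmultiples j).out := fun i =>
    mem_zmultiples_iff.1 (sub_out_mem _ i)
  let κ : G → ℤ := fun i => (hex i).choose
  have hκ : ∀ i, κ i • j = i - (i : G ⧸ zmultiples j).out := fun i => (hex i).choose_spec
  { toFun := fun F => ⟨fun o => F.1 o.out, fun o o' h => by
      obtain ⟨k, hk⟩ := mem_zmultiples_iff.1 (QuotientAddGroup.eq_iff_sub_mem.1 h)
      have h1 : F.1 o.out = F.1 (o'.out + k • j) := by
        rw [F.apply_add_zsmul, hk]; abel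
      have h2 := congrArg (QuotientAddGroup.mk (s := zmultiples j)) (F.2.1 h1)
      rw [QuotientAddGroup.mk_add_of_mem _ (zsmul_mem (mem_zmultiples j) k),
        QuotientAddGroup.out_eq', QuotientAddGroup.out_eq'] at h2
      exact h2⟩
    invFun := fun y => ⟨fun i => y.1 i + κ i • c, by
      constructor
      · intro i i' h
        have h1 : (i : G ⧸ zmultiples j) = i' := by
          apply y.2
          have := congrArg (QuotientAddGroup.mk (s := zmultiples c)) h
          simpa only [QuotientAddGroup.mk_add_of_mem _ (zsmul_mem (mem_zmultiples c) _)] using this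
        simp only [h1, add_right_inj, ← zsmul_eq_zsmul_iff_of_addOrderOf_eq hd, hκ,
          sub_left_inj] at h
        exact h
      · intro i
        have h1 : ((i + j : G) : G ⧸ zmultiples j) = i :=
          QuotientAddGroup.mk_add_of_mem _ (mem_zmultiples j)
        have h2 : κ (i + j) • c = (κ i + 1) • c := by
          rw [← zsmul_eq_zsmul_iff_of_addOrderOf_eq hd, hκ, h1, add_zsmul, hκ, one_zsmul]
          abel
        simp only [h2, h1]
        rw [add_zsmul, one_zsmul, add_assoc]⟩
    left_inv := fun F => by
      ext i
      simp only
      rw [← F.apply_add_zsmul, hκ, add_sub_cancel]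
    right_inv := fun y => by
      ext o
      -- The chosen coefficient at a representative need not be 0, only a multiple of the common
      -- order.
      have h : κ o.out • c = (0 : ℤ) • c := by
        rw [← zsmul_eq_zsmul_iff_of_addOrderOf_eq hd, hκ, QuotientAddGroup.out_eq', sub_self,
          zero_zsmul]
      simp only [h, QuotientAddGroup.out_eq', zero_zsmul, add_zero] }

/-- Lifts of injections along a quotient map of groups. -/
def liftInjectiveEquiv (C : AddSubgroup H) (Q : Type*) :
    {y : Q → H // Function.Injective fun o => (y o : H ⧸ C)} ≃ (Q ↪ H ⧸ C) × (Q → C) where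
  toFun y := (⟨_, y.2⟩, fun o => ⟨_, sub_out_mem C (y.1 o)⟩)
  invFun p := ⟨fun o => (p.1 o).out + p.2 o, by
    simpa only [QuotientAddGroup.mk_add_of_mem _ (SetLike.coe_mem _), QuotientAddGroup.out_eq']
      using p.1.injective⟩
  left_inv y := by
    ext o
    simp
  right_inv p := by
    have h : ∀ o, (((p.1 o).out + p.2 o : H) : H ⧸ C) = p.1 o := fun o => by
      rw [QuotientAddGroup.mk_add_of_mem _ (SetLike.coe_mem _), QuotientAddGroup.out_eq']
    refine Prod.ext (DFunLike.ext _ _ h) (funext fun o => Subtype.ext ?_)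
    simp only [h]
    abel

theorem card_lift_injective [Finite H] (C : AddSubgroup H) (Q : Type*) [Finite Q] :
    Nat.card {y : Q → H // Function.Injective fun o => (y o : H ⧸ C)} =
      (Nat.card (H ⧸ C)).descFactorial (Nat.card Q) * Nat.card C ^ Nat.card Q := by
  classical
  have := Fintype.ofFinite Q
  have := Fintype.ofFinite (H ⧸ C)
  rw [Nat.card_congr (liftInjectiveEquiv C Q), Nat.card_prod, Nat.card_fun,
    Nat.card_eq_fintype_card (α := Q ↪ H ⧸ C), Fintype.card_embedding_eq, Nat.card_eq_fintype_card (α := H ⧸ C),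
    Nat.card_eq_fintype_card (α := Q)]

theorem card_quotient_zmultiples [Finite G] (a : G) :
    Nat.card (G ⧸ AddSubgroup.zmultiples a) = Nat.card G / addOrderOf a := by
  rw [AddSubgroup.card_eq_card_quotient_mul_card_addSubgroup (AddSubgroup.zmultiples a),
    Nat.card_zmultiples, Nat.mul_div_cancel _ (addOrderOf_pos a)]

theorem card_shiftInj [Finite G] [Finite H] {j : G} {c : H} (hd : addOrderOf j = addOrderOf c) :
    Nat.card (ShiftInj j c) = (Nat.card H / addOrderOf j).descFactorial
      (Nat.card G / addOrderOf j) * addOrderOf j ^ (Nat.card G / addOrderOf j) := by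
  rw [Nat.card_congr (shiftInjEquiv hd), card_lift_injective, card_quotient_zmultiples,
    card_quotient_zmultiples, Nat.card_zmultiples, hd]

/-- Sorting the injective maps that intertwine translation by `j` with some translation. -/
def sigmaShiftInjEquiv (j : G) :
    (Σ c : H, ShiftInj j c) ≃
      {F : G → H // Function.Injective F ∧ ∃ c, ∀ i, F (i + j) = F i + c} where
  toFun p := ⟨p.2.1, p.2.2.1, p.1, p.2.2.2⟩
  -- The shift `c` is determined by `F`, so the sets for different `c` are disjoint.
  invFun F := ⟨F.1 (0 + j) - F.1 0, F.1, F.2.1, fun i => by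
    obtain ⟨c, hc⟩ := F.2.2
    rw [hc, hc]
    abel⟩
  left_inv := by
    rintro ⟨c, F, hF, hc⟩
    obtain rfl : F (0 + j) - F 0 = c := by rw [hc]; abel
    rfl
  right_inv F := rfl

/-- Only shifts `c` of the same order as `j` contribute, all equally. As ℤ/q is cyclic, their number
is a totient when that order divides q; otherwise there are none. -/
theorem card_shift_zmod [Finite G] (j : G) (q : ℕ) [NeZero q] :
    Nat.card {F : G → ZMod q // Function.Injective F ∧ ∃ c, ∀ i, F (i + j) = F i + c} =
      if addOrderOf j ∣ q then Nat.totient (addOrderOf j) * ((q / addOrderOf j).descFactorial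
        (Nat.card G / addOrderOf j) * addOrderOf j ^ (Nat.card G / addOrderOf j)) else 0 := by
  classical
  have hterm : ∀ c : ZMod q, Nat.card (ShiftInj j c) = if addOrderOf c = addOrderOf j then
      (q / addOrderOf j).descFactorial (Nat.card G / addOrderOf j) *
        addOrderOf j ^ (Nat.card G / addOrderOf j) else 0 := by
    intro c
    split_ifs with h
    · rw [card_shiftInj h.symm, Nat.card_zmod]
    · have : IsEmpty (ShiftInj j c) := ⟨fun F => h F.addOrderOf_eq⟩
      exact Nat.card_of_isEmpty
  rw [← Nat.card_congr (sigmaShiftInjEquiv j), Nat.card_sigma,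
    Finset.sum_congr rfl fun c _ => hterm c, ← Finset.sum_filter, Finset.sum_const, smul_eq_mul]
  split_ifs with h
  · rw [IsAddCyclic.card_addOrderOf_eq_totient (by rwa [ZMod.card])]
  · rw [Finset.card_eq_zero.2, zero_mul]
    refine Finset.filter_eq_empty_iff.2 fun c _ hc => h ?_
    rw [← hc]
    simpa using addOrderOf_dvd_card (x := c)

end Counting

/-- In the basis of points, the diagonal entry at `x` is 1 if `g` fixes `x` and 0 otherwise. -/
theorem character_ofMulAction {G X : Type*} [Group G] [MulAction G X] [Finite X] (g : G) :
    (Representation.ofMulAction ℂ G X).character g = Nat.card {x : X // g • x = x} := by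
  classical
  have := Fintype.ofFinite X
  rw [Representation.character, LinearMap.trace_eq_matrix_trace ℂ (MonoidAlgebra.basis X ℂ),
    Matrix.trace, Nat.card_eq_fintype_card, Fintype.card_subtype, Finset.card_filter]
  push_cast
  refine Finset.sum_congr rfl fun x _ => ?_
  rw [Matrix.diag_apply, LinearMap.toMatrix_apply, MonoidAlgebra.basis_apply,
    Representation.ofMulAction_single]
  exact Finsupp.single_apply

/-! ### Reduction modulo q: fixed points as intertwining injections. -/

section Reduction

variable {ι M N : Type*} [AddCommGroup M] [Module ℝ M] [AddCommGroup N] [Module ℝ N]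
  {P : RootPairing ι ℝ M N} {b : P.Base} {l : ℕ} {e : Fin l ≃ b.support}

variable (b e) in
theorem exists_coord_eq_intCast {x : N} (hx : ∀ k, ∃ z : ℤ, P.root' (e k) x = z)
    (i : Fin (l + 1)) : ∃ z : ℤ, coord b e x i = z := by
  choose z hz using hx
  refine ⟨∑ k : Fin l, if (k : ℕ) < i then z k else 0, ?_⟩
  simp [coord, hz]

variable (b e) in
/-- The integral coordinates of a point of the coweight lattice. -/
def intCoord (x : coweightLattice P) (i : Fin (l + 1)) : ℤ :=
  (exists_coord_eq_intCast b e (fun k => x.2 (e k)) i).choose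

theorem coord_eq_intCoord (x : coweightLattice P) (i : Fin (l + 1)) :
    coord b e x i = intCoord b e x i :=
  (exists_coord_eq_intCast b e (fun k => x.2 (e k)) i).choose_spec

variable (b e) in
/-- The coordinates of a point of the coweight lattice modulo `q`. -/
def reduction (q : ℕ) : coweightLattice P →+ (Fin (l + 1) → ZMod q) :=
  AddMonoidHom.mk' (fun x i => (intCoord b e x i : ZMod q)) fun x y => by
    ext i
    have h : intCoord b e (x + y) i = intCoord b e x i + intCoord b e y i := by
      have := coord_add b e x y i
      rw [← AddSubgroup.coe_add, coord_eq_intCoord, coord_eq_intCoord, coord_eq_intCoord] at this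
      exact_mod_cast this
    simp [h]

theorem reduction_apply (q : ℕ) (x : coweightLattice P) (i : Fin (l + 1)) :
    reduction b e q x i = (intCoord b e x i : ZMod q) := rfl

theorem reduction_zero_index (q : ℕ) (x : coweightLattice P) : reduction b e q x 0 = 0 := by
  have h := coord_eq_intCoord (b := b) (e := e) x 0
  rw [coord_zero_index] at h
  rw [reduction_apply, show intCoord b e x 0 = 0 by exact_mod_cast h.symm, Int.cast_zero]

theorem reduction_eq_iff (q : ℕ) (x : coweightLattice P) (a c : Fin (l + 1)) :
    reduction b e q x a = reduction b e q x c ↔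
      ∃ k : ℤ, coord b e x a - coord b e x c = q * k := by
  rw [reduction_apply, reduction_apply, ← sub_eq_zero, ← Int.cast_sub,
    ZMod.intCast_zmod_eq_zero_iff_dvd, coord_eq_intCoord, coord_eq_intCoord]
  constructor
  · rintro ⟨k, hk⟩
    exact ⟨k, by exact_mod_cast hk⟩
  · rintro ⟨k, hk⟩
    exact ⟨k, by exact_mod_cast hk⟩

variable [P.IsCrystallographic] [Finite ι] [P.IsReduced]

theorem mem_coweightLattice (hA : IsTypeA b e) {x : N} (hx : ∀ k, ∃ z : ℤ, P.root' (e k) x = z) :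
    x ∈ coweightLattice P := by
  intro i
  obtain ⟨a, c, -, h⟩ := exists_root'_eq_coord_sub hA i
  obtain ⟨z, hz⟩ := exists_coord_eq_intCast b e hx a
  obtain ⟨z', hz'⟩ := exists_coord_eq_intCast b e hx c
  exact ⟨z - z', by rw [h, hz, hz', Int.cast_sub]⟩

variable [P.IsRootSystem]

/-- If all coordinates are divisible by q, so are the values of the simple roots; the point with the
quotients as simple root values is in the lattice, because every root is a difference of integral
coordinates. -/
theorem ker_reduction (hA : IsTypeA b e) (q : ℕ) [NeZero q] :
    (reduction b e q).ker = multiples P q := by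
  ext x
  constructor
  · intro hx
    have hx' : ∀ k, ∃ z : ℤ, P.root' (e k) x = q * z := fun k => by
      rw [← coord_succ_sub b e, ← reduction_eq_iff, AddMonoidHom.mem_ker.1 hx]
      rfl
    choose z hz using hx'
    obtain ⟨y, hy⟩ := exists_root'_eq b e fun k => (z k : ℝ)
    refine ⟨⟨y, mem_coweightLattice hA fun k => ⟨_, hy k⟩⟩, Subtype.ext ?_⟩
    refine eq_of_root'_eq (e := e) fun k => ?_
    simp [hz, hy]
  · rintro ⟨y, rfl⟩
    rw [AddMonoidHom.mem_ker, nsmulAddMonoidHom_apply, map_nsmul]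
    ext i
    simp

theorem exists_reduction_eq (hA : IsTypeA b e) {q : ℕ} (F : Fin (l + 1) → ZMod q) (hF : F 0 = 0) :
    ∃ x, reduction b e q x = F := by
  choose a ha using fun i => ZMod.intCast_surjective (F i)
  obtain ⟨x, hx⟩ := exists_root'_eq b e fun k => ((a k.succ - a k.castSucc : ℤ) : ℝ)
  refine ⟨⟨x, mem_coweightLattice hA fun k => ⟨_, hx k⟩⟩, ?_⟩
  obtain ⟨c, hc⟩ := exists_eq_add_of_succ_sub_eq (coord b e x) (fun i => (a i : ℝ)) fun k => by
    rw [coord_succ_sub, hx, Int.cast_sub]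
  have hc0 := hc 0
  rw [coord_zero_index] at hc0
  ext i
  rw [reduction_apply, show intCoord b e ⟨x, _⟩ i = a i - a 0 by
    have h := hc i
    rw [show c = -(a 0 : ℝ) by linarith, ← sub_eq_add_neg] at h
    have h' := (coord_eq_intCoord (b := b) (e := e)
      ⟨x, mem_coweightLattice hA fun k => ⟨_, hx k⟩⟩ i).symm.trans h
    exact_mod_cast h', Int.cast_sub, ha, ha, hF, sub_zero]

/-- Reduction modulo `q`, together with a common shift, identifies `Z / qZ × ℤ / q` with the
`q`-residue vectors. -/
def latticeModProdEquiv (hA : IsTypeA b e) (q : ℕ) [NeZero q] :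
    LatticeMod P q × ZMod q ≃ (Fin (l + 1) → ZMod q) :=
  Equiv.ofBijective
    (fun p i => QuotientAddGroup.lift (multiples P q) (reduction b e q)
      (ker_reduction hA q).ge p.1 i + p.2) (by
    constructor
    · rintro ⟨t, u⟩ ⟨t', u'⟩ h
      induction t using QuotientAddGroup.induction_on with | H x => ?_
      induction t' using QuotientAddGroup.induction_on with | H y => ?_
      simp only [QuotientAddGroup.lift_mk] at h
      have h0 := congrFun h 0
      simp only [reduction_zero_index, zero_add] at h0
      subst h0
      refine Prod.ext (QuotientAddGroup.eq_iff_sub_mem.2 ?_) rfl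
      rw [← ker_reduction hA q, AddMonoidHom.mem_ker, map_sub, sub_eq_zero]
      ext i
      simpa using congrFun h i
    · intro F
      obtain ⟨x, hx⟩ := exists_reduction_eq hA (fun i => F i - F 0) (sub_self _)
      refine ⟨(QuotientAddGroup.mk x, F 0), ?_⟩
      ext i
      simp [hx])

theorem latticeModProdEquiv_mk (hA : IsTypeA b e) (q : ℕ) [NeZero q] (x : coweightLattice P)
    (u : ZMod q) (i : Fin (l + 1)) :
    latticeModProdEquiv hA q (QuotientAddGroup.mk x, u) i = reduction b e q x i + u := rfl

theorem mk_eq_mk_iff (hA : IsTypeA b e) (q : ℕ) [NeZero q] (x y : coweightLattice P) :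
    (QuotientAddGroup.mk x : LatticeMod P q) = QuotientAddGroup.mk y ↔
      reduction b e q x = reduction b e q y := by
  rw [QuotientAddGroup.eq_iff_sub_mem, ← ker_reduction hA q, AddMonoidHom.mem_ker, map_sub,
    sub_eq_zero]

theorem finite_latticeMod (hA : IsTypeA b e) (q : ℕ) [NeZero q] : Finite (LatticeMod P q) :=
  Finite.of_injective (fun t => latticeModProdEquiv hA q (t, 0)) fun t t' h => by
    simpa using h

/-- Roots and differences of two distinct coordinates are the same functionals, so avoiding all
hyperplanes modulo q means having distinct residues. -/
theorem mk_mem_complement_iff (hA : IsTypeA b e) (q : ℕ) [NeZero q] (x : coweightLattice P) :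
    (QuotientAddGroup.mk x : LatticeMod P q) ∈ complement P q ↔
      Function.Injective (reduction b e q x) := by
  constructor
  · rintro ⟨y, hy, hroot⟩ a c hac
    by_contra hne
    rw [mk_eq_mk_iff hA] at hy
    rw [← hy, reduction_eq_iff] at hac
    obtain ⟨i, hi⟩ := exists_root'_eq_coord_sub_of_ne hA hne
    exact hroot i (by simpa only [hi] using hac)
  · intro hinj
    refine ⟨x, rfl, fun i hi => ?_⟩
    obtain ⟨a, c, hac, h⟩ := exists_root'_eq_coord_sub hA i
    rw [h, ← reduction_eq_iff] at hi
    exact hac (hinj hi)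

/-- The action permutes residues up to a shift. Conversely, two normalized residue vectors that
differ by a constant agree, since both vanish at index 0. -/
theorem modAct_mk_eq_iff (hA : IsTypeA b e) (q : ℕ) [NeZero q] (w : P.weylGroup)
    (x : coweightLattice P) :
    modAct P q w (QuotientAddGroup.mk x) = QuotientAddGroup.mk x ↔
      ∃ c, ∀ i, reduction b e q x (permHom hA w i) = reduction b e q x i + c := by
  have hact : ∃ c, ∀ i, reduction b e q (latticeAct P w x) (permHom hA w i) =
      reduction b e q x i + c := by
    refine ⟨reduction b e q (latticeAct P w x) (permHom hA w 0), fun i => ?_⟩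
    have h := coord_of_actsAs (actsAs_permHom hA w) (x : N) i 0
    change coord b e (latticeAct P w x : N) _ - coord b e (latticeAct P w x : N) _ = _ at h
    simp only [coord_eq_intCoord] at h
    have h' : intCoord b e (latticeAct P w x) (permHom hA w i) -
        intCoord b e (latticeAct P w x) (permHom hA w 0) =
        intCoord b e x i - intCoord b e x 0 := by exact_mod_cast h
    have h0 := reduction_zero_index (b := b) (e := e) q x
    have h'' := congrArg (Int.cast : ℤ → ZMod q) h'
    rw [Int.cast_sub, Int.cast_sub, ← reduction_apply, ← reduction_apply, ← reduction_apply,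
      ← reduction_apply, h0, sub_zero] at h''
    rw [← h'', sub_add_cancel]
  change (QuotientAddGroup.mk (latticeAct P w x) : LatticeMod P q) = _ ↔ _
  rw [mk_eq_mk_iff hA]
  obtain ⟨c, hc⟩ := hact
  constructor
  · intro h
    exact ⟨c, fun i => by rw [← hc, h]⟩
  · rintro ⟨c', hc'⟩
    have hdiff : ∀ i, reduction b e q (latticeAct P w x) i = reduction b e q x i + (c - c') := by
      intro i
      obtain ⟨i, rfl⟩ := (permHom hA w).surjective i
      rw [hc, hc']
      abel
    have h0 := hdiff 0
    rw [reduction_zero_index, reduction_zero_index, zero_add] at h0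
    ext i
    rw [hdiff, ← h0, add_zero]

/-- The factor q accounts for the common shift lost by normalizing; neither injectivity nor the
intertwining condition depends on it. -/
theorem card_fixed_mul (hA : IsTypeA b e) (q : ℕ) [NeZero q] (w : P.weylGroup) :
    Nat.card {t : complement P q // w • t = t} * q =
      Nat.card {F : Fin (l + 1) → ZMod q //
        Function.Injective F ∧ ∃ c, ∀ i, F (permHom hA w i) = F i + c} := by
  have E1 : {t : complement P q // w • t = t} ≃
      {t : LatticeMod P q // t ∈ complement P q ∧ modAct P q w t = t} :=
    { toFun := fun t => ⟨t.1.1, t.1.2, congrArg Subtype.val t.2⟩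
      invFun := fun t => ⟨⟨t.1, t.2.1⟩, Subtype.ext t.2.2⟩
      left_inv := fun _ => rfl
      right_inv := fun _ => rfl }
  have E2 : {t : LatticeMod P q // t ∈ complement P q ∧ modAct P q w t = t} × ZMod q ≃
      {p : LatticeMod P q × ZMod q // p.1 ∈ complement P q ∧ modAct P q w p.1 = p.1} :=
    { toFun := fun p => ⟨(p.1.1, p.2), p.1.2⟩
      invFun := fun p => (⟨p.1.1, p.2⟩, p.1.2)
      left_inv := fun _ => rfl
      right_inv := fun _ => rfl }
  have E3 := (latticeModProdEquiv hA q).subtypeEquiv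
    (p := fun p => p.1 ∈ complement P q ∧ modAct P q w p.1 = p.1)
    (q := fun F => Function.Injective F ∧ ∃ c, ∀ i, F (permHom hA w i) = F i + c) (by
      rintro ⟨t, u⟩
      induction t using QuotientAddGroup.induction_on with | H x => ?_
      rw [mk_mem_complement_iff hA, modAct_mk_eq_iff hA]
      simp only [latticeModProdEquiv_mk]
      refine and_congr ?_ (exists_congr fun c => forall_congr' fun i => ?_)
      · exact ((add_left_injective u).of_comp_iff _).symm
      · rw [add_right_comm, add_left_inj])
  rw [← Nat.card_congr E3, ← Nat.card_congr E2, Nat.card_prod, Nat.card_zmod, Nat.card_congr E1]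

theorem equivChar_mul (hA : IsTypeA b e) (q : ℕ) [NeZero q] (w : P.weylGroup) :
    equivChar P q w * q = Nat.card {F : Fin (l + 1) → ZMod q //
        Function.Injective F ∧ ∃ c, ∀ i, F (permHom hA w i) = F i + c} := by
  have := finite_latticeMod hA q
  rw [equivChar, character_ofMulAction, ← card_fixed_mul, Nat.cast_mul]

theorem orderOf_omega (hA : IsTypeA b e) (j : Fin (l + 1)) :
    orderOf (omega b e j) = addOrderOf j := by
  rw [← orderOf_injective (permHom hA) (permHom_injective hA), permHom_omega]
  have hpow : ∀ (n : ℕ) (i : Fin (l + 1)), (Equiv.addRight j ^ n) i = i + n • j := by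
    intro n
    induction n with
    | zero => simp
    | succ n ih =>
      intro i
      rw [pow_succ', Equiv.Perm.mul_apply, ih, succ_nsmul]
      exact add_assoc _ _ _
  refine Nat.dvd_antisymm (orderOf_dvd_of_pow_eq_one (Equiv.ext fun i => ?_))
    (addOrderOf_dvd_of_nsmul_eq_zero ?_)
  · rw [hpow, addOrderOf_nsmul_eq_zero, add_zero, Equiv.Perm.one_apply]
  · have h := hpow (orderOf (Equiv.addRight j)) 0
    rwa [pow_orderOf_eq_one, Equiv.Perm.one_apply, zero_add, eq_comm] at h

end Reduction

/-! ### Arithmetic of the final formula. -/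

theorem addOrderOf_fin {l : ℕ} (j : Fin (l + 1)) :
    addOrderOf j = (l + 1) / Nat.gcd (l + 1) j := by
  have h := ZMod.addOrderOf_coe (j : ℕ) (Nat.succ_ne_zero l)
  rwa [show ((j : ℕ) : ZMod (l + 1)) = j from Fin.cast_val_eq_self j] at h

/-- With q = dm, spreading the powers of d over m(m-1)⋯(m-g+1) gives the factors q - dk for 0 ≤ k <
g; the factor k = 0 is the trailing q. -/
theorem cast_descFactorial_mul_pow {q d g : ℕ} (hd : d ∣ q) (hg : 0 < g) (hd0 : d ≠ 0) :
    (((q / d).descFactorial g * d ^ g : ℕ) : ℂ) =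
      (∏ k ∈ Finset.Ico 1 g, ((q : ℂ) - (d : ℂ) * (k : ℂ))) * q := by
  obtain ⟨m, rfl⟩ := hd
  rw [Nat.mul_div_cancel_left _ (Nat.pos_of_ne_zero hd0)]
  obtain ⟨g, rfl⟩ : ∃ g', g = g' + 1 := ⟨g - 1, by omega⟩
  induction g with
  | zero =>
    simp
    ring
  | succ g ih =>
    have hcast : (((m - (g + 1)) * m.descFactorial (g + 1) : ℕ) : ℂ) =
        ((m : ℂ) - ((g + 1 : ℕ) : ℂ)) * (m.descFactorial (g + 1) : ℕ) := by
      -- Truncated subtraction is wrong only when m < g + 1, and then the falling factorial already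
      -- vanishes.
      rcases le_or_gt (g + 1) m with h | h
      · rw [Nat.cast_mul, Nat.cast_sub h]
      · rw [Nat.descFactorial_eq_zero_iff_lt.2 h]
        simp
    have ih' := ih (Nat.succ_pos g)
    rw [Nat.cast_mul] at ih'
    rw [Finset.prod_Ico_succ_top (by omega), mul_right_comm, ← ih',
      Nat.descFactorial_succ, Nat.cast_mul, hcast, pow_succ]
    push_cast
    ring

end EquivariantQuasi

end

theorem mainTheorem5 {ι M N : Type*} [Finite ι] [AddCommGroup M] [Module ℝ M]
    [AddCommGroup N] [Module ℝ N] (P : RootPairing ι ℝ M N) [P.IsRootSystem]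
    [P.IsCrystallographic] [P.IsReduced] (b : P.Base) (l : ℕ) (e : Fin l ≃ b.support)
    (hA : EquivariantQuasi.IsTypeA b e) (j : Fin (l + 1)) (g d : ℕ)
    (hg : g = Nat.gcd (l + 1) (j : ℕ)) (hd : d = orderOf (EquivariantQuasi.omega b e j))
    (q : ℕ) (hq : 0 < q) :
    (¬ d ∣ q → EquivariantQuasi.equivChar P q (EquivariantQuasi.omega b e j) = 0) ∧
    (d ∣ q → EquivariantQuasi.equivChar P q (EquivariantQuasi.omega b e j) =
      (Nat.totient d : ℂ) * ∏ k ∈ Finset.Ico 1 g, ((q : ℂ) - (d : ℂ) * (k : ℂ))) := by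
  have : NeZero q := ⟨hq.ne'⟩
  have hqC : (q : ℂ) ≠ 0 := Nat.cast_ne_zero.2 hq.ne'
  rw [EquivariantQuasi.orderOf_omega hA] at hd
  have hd0 : 0 < d := hd ▸ addOrderOf_pos j
  have hg0 : 0 < g := hg ▸ Nat.gcd_pos_of_pos_left _ (Nat.succ_pos l)
  -- The number of orbits of translation by `j`: here d = (ℓ+1)/g with g dividing ℓ+1.
  have hcard : Nat.card (Fin (l + 1)) / d = g := by
    rw [hd, EquivariantQuasi.addOrderOf_fin, Nat.card_eq_fintype_card, Fintype.card_fin, ← hg]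
    exact Nat.div_div_self (hg ▸ Nat.gcd_dvd_left _ _) (Nat.succ_ne_zero l)
  have key := EquivariantQuasi.equivChar_mul hA q (EquivariantQuasi.omega b e j)
  rw [EquivariantQuasi.permHom_omega hA] at key
  simp only [Equiv.coe_addRight] at key
  rw [EquivariantQuasi.card_shift_zmod, ← hd, hcard] at key
  constructor
  · intro h
    rw [if_neg h, Nat.cast_zero] at key
    exact (mul_eq_zero.1 key).resolve_right hqC
  · intro h
    rw [if_pos h, Nat.cast_mul, EquivariantQuasi.cast_descFactorial_mul_pow h hg0 hd0.ne',
      ← mul_assoc] at key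
    exact mul_right_cancel₀ hqC key
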